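/- Let $F=\mathbf F_q$ be a finite field, $R=F[T]$ and $k=F(T)$. Let $a\in R$ be a non-constant polynomial such that $A=2a+1$ is monic, and suppose that $A=Z^n$ with $n\ge 1$ and $Z\in R$ non-constant. Let $d\ge 0$ be an integer and let $D\in R$ be a square-free polynomial of one of the forms (1) $D=(A^d+a)^2+A$, (2) $D=(A^d-a)^2+A$, (3) $D=(A^d+a+1)^2-A$, (4) $D=(A^d-a-1)^2-A$, where in the forms (1) and (3) the case that $d=1$ and $F$ has characteristic $3$ (in which the leading terms of $A^d$ and $a$ cancel) is excluded. Let $K=k(\sqrt D)$ and let $H(D)$ be its ideal class group, i.e. the group of fractional ideals modulo principal ideals of the integral closure of $R$ in $K$. Then $H(D)$ contains a cyclic subgroup of order $n$. Moreover, if $d\ge 2$, then $D$ is neither of ERD type nor of GERD type: there are no $f,r\in R$ with $f\neq 0$, $D=f^2+r$ and $r\mid f$, and none with $f\ne0$, $D=f^2+r$ and $r\mid 2^m f$ for some integer $m\ge 2$. -/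

import Mathlib

open Polynomial

/-- `K` is the field `F(T)(√D)`: it is generated over the rational function field `F(T)` by a
square root of the polynomial `D`. -/
def IsAdjoinSqrt (F : Type*) [Field F] (K : Type*) [Field K] [Algebra F[X] K]
    [Algebra (RatFunc F) K] (D : F[X]) : Prop :=
  ∃ s : K, s ^ 2 = algebraMap F[X] K D ∧ IntermediateField.adjoin (RatFunc F) {s} = ⊤

/-- The ideal class group of the ring of integers of `K`, the integral closure of `F[T]` in `K`:
the fractional ideals modulo the principal ones. -/
abbrev IdealClassGroup (F : Type*) [Field F] (K : Type*) [Field K] [Algebra F[X] K] : Type _ :=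
  ClassGroup (FunctionField.ringOfIntegers F K)

/-- `D` is of ERD type: `D = f² + r` with `r ∣ f`. As every `r` divides `0`, the condition
`f ≠ 0` is needed; it is the weakest one possible (it follows from `deg r < deg f`). -/
def IsERD {F : Type*} [Field F] (D : F[X]) : Prop :=
  ∃ f r : F[X], f ≠ 0 ∧ D = f ^ 2 + r ∧ r ∣ f

/-- `D` is of GERD type: `D = f² + r` with `r ∣ 2 ^ m * f` for some `m ≥ 2`. -/
def IsGERD {F : Type*} [Field F] (D : F[X]) : Prop :=
  ∃ (f r : F[X]) (m : ℕ), 2 ≤ m ∧ f ≠ 0 ∧ D = f ^ 2 + r ∧ r ∣ 2 ^ m * f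

/-! In each of the four forms, with `s = √D`, there are polynomials `f`, `g` differing by a nonzero
constant such that `f ^ 2 - D = c * A` and `g ^ 2 - D = c' * A ^ d`, where `c`, `c'` are nonzero
constants. Put `α = f + s`. Its norm is `c * Z ^ n` and `α` is coprime to its conjugate, so `(α) = I
^ n`; the class of `I` should have order exactly `n`. Infinity splits in `K`: the leading
coefficient of `D` is a square and its degree is `2 * N`, so `K` embeds in the Laurent series in
`1/T`. This gives a pole order `ν`, and `ν ∘ σ` is the other one, `σ` being the conjugation. Up to a
unit, `g - s` is `α ^ d`; this yields `θ`, a unit times a power of `α`, with pole orders `(0, N)`,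
while `α` has order `N` at the first place. If `I ^ j = (δ)` with `0 < j < n`, multiplying `δ` by
powers of `α` and `θ` brings both pole orders into `[0, N)` (`false_of_pow_eq`). The result, or its
inverse, is integral and not in `k`, hence has order at least `N` at some infinite place
(`le_poleOrder_or_le`), a contradiction. For ERD and GERD types, degrees force any competing `f` to
be `±f₀` plus a constant, and `A ∤ f₀` with `0 < deg A < deg f₀` finishes (`not_dvd_of_eq_sq_add`).
-/

/-! ### Laurent expansions at infinity and the square root of `D` -/

/-- The substitution `T ↦ 1/X`, which expands a polynomial at the place at infinity. -/
noncomputable def expandAtInfty (F : Type*) [Field F] : F[X] →+* LaurentSeries F :=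
  eval₂RingHom HahnSeries.C (HahnSeries.single (-1) 1)

lemma expandAtInfty_eq_reverse {F : Type*} [Field F] (p : F[X]) :
    expandAtInfty F p =
      HahnSeries.ofPowerSeries ℤ F (p.reverse : PowerSeries F) *
        (HahnSeries.single (-1) 1) ^ p.natDegree := by
  have hmul : (HahnSeries.single (-1 : ℤ) (1 : F)) * HahnSeries.single (1 : ℤ) (1 : F) = 1 := by
    rw [HahnSeries.single_mul_single]; simp
  let _ : Invertible (HahnSeries.single (-1 : ℤ) (1 : F)) :=
    invertibleOfRightInverse _ _ hmul
  have h := eval₂_reverse_mul_pow (HahnSeries.C : F →+* LaurentSeries F)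
    (HahnSeries.single (-1 : ℤ) (1 : F)) p
  have hinv : ⅟ (HahnSeries.single (-1 : ℤ) (1 : F)) = HahnSeries.single (1 : ℤ) (1 : F) := rfl
  rw [hinv] at h
  have hom : eval₂RingHom (HahnSeries.C : F →+* LaurentSeries F) (HahnSeries.single (1 : ℤ) (1 : F))
      = (HahnSeries.ofPowerSeries ℤ F).comp (coeToPowerSeries.ringHom (R := F)) := by
    apply Polynomial.ringHom_ext
    · intro a
      simp
    · simp
  have h2 := congrArg (fun φ : F[X] →+* LaurentSeries F => φ p.reverse) hom
  simp only [coe_eval₂RingHom, RingHom.comp_apply, coeToPowerSeries.ringHom_apply] at h2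
  rw [← h2, h]
  rfl

/-- The series and its inverse both have nonnegative order, and the two orders sum to zero. -/
lemma order_ofPowerSeries_eq_zero {F : Type*} [Field F] (p : PowerSeries F)
    (h : PowerSeries.constantCoeff p ≠ 0) : (HahnSeries.ofPowerSeries ℤ F p).order = 0 := by
  obtain ⟨u, hu⟩ := (PowerSeries.isUnit_iff_constantCoeff.2 (isUnit_iff_ne_zero.2 h)).exists_right_inv
  have nonneg : ∀ q : PowerSeries F, 0 ≤ (HahnSeries.ofPowerSeries ℤ F q).order := by
    intro q
    rcases eq_or_ne (HahnSeries.ofPowerSeries ℤ F q) 0 with hq | hq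
    · simp [hq]
    · by_contra hlt
      push Not at hlt
      have h1 := HahnSeries.coeff_order_eq_zero.not.2 hq
      apply h1
      rw [HahnSeries.ofPowerSeries_apply]
      apply HahnSeries.embDomain_of_notMem_range
      rintro ⟨i, hi⟩
      simp at hi
      rw [HahnSeries.ofPowerSeries_apply] at hlt
      omega
  have hne : HahnSeries.ofPowerSeries ℤ F p * HahnSeries.ofPowerSeries ℤ F u = 1 := by
    rw [← map_mul, hu, map_one]
  have h3 := HahnSeries.order_mul (left_ne_zero_of_mul_eq_one hne) (right_ne_zero_of_mul_eq_one hne)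
  rw [hne, HahnSeries.order_one] at h3
  have := nonneg p
  have := nonneg u
  omega

lemma expandAtInfty_order {F : Type*} [Field F] {p : F[X]} (hp : p ≠ 0) :
    expandAtInfty F p ≠ 0 ∧ (expandAtInfty F p).order = -(p.natDegree : ℤ) := by
  have hc : PowerSeries.constantCoeff (p.reverse : PowerSeries F) ≠ 0 := by
    simpa [coeff_zero_reverse] using hp
  have h0 : HahnSeries.ofPowerSeries ℤ F (p.reverse : PowerSeries F) ≠ 0 := by
    intro h
    have h1 : (p.reverse : PowerSeries F) = 0 :=
      HahnSeries.ofPowerSeries_injective (by rw [h, map_zero])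
    exact hc (by rw [h1, map_zero])
  have h1 : (HahnSeries.single (-1 : ℤ) (1 : F)) ≠ 0 := HahnSeries.single_ne_zero one_ne_zero
  rw [expandAtInfty_eq_reverse]
  refine ⟨mul_ne_zero h0 (pow_ne_zero _ h1), ?_⟩
  rw [HahnSeries.order_mul h0 (pow_ne_zero _ h1), order_ofPowerSeries_eq_zero _ hc,
    HahnSeries.order_pow, HahnSeries.order_single one_ne_zero]
  simp

/-- Hensel's lemma for the `X`-adic topology: `c` is a simple root modulo `X`, the derivative `2 *
c` being nonzero. -/
lemma powerSeries_exists_sq_eq {F : Type*} [Field F] (h2 : (2 : F) ≠ 0) (p : PowerSeries F) {c : F}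
    (hc : c ≠ 0) (hp : PowerSeries.constantCoeff p = c ^ 2) : ∃ q : PowerSeries F, q ^ 2 = p := by
  have key := HenselianRing.is_henselian (R := PowerSeries F)
    (I := Ideal.span {PowerSeries.X}) (X ^ 2 - C p) (monic_X_pow_sub_C p two_ne_zero)
    (PowerSeries.C c) (by
      rw [Ideal.mem_span_singleton, PowerSeries.X_dvd_iff]
      simp [hp]) (by
      apply IsUnit.map
      rw [PowerSeries.isUnit_iff_constantCoeff]
      have h2' : (PowerSeries.constantCoeff (2 : PowerSeries F)) = 2 := map_ofNat _ 2
      simp [one_add_one_eq_two, h2', h2, hc])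
  obtain ⟨q, hq, -⟩ := key
  refine ⟨q, ?_⟩
  simpa [IsRoot, sub_eq_zero] using hq

lemma exists_sq_eq_expandAtInfty {F : Type*} [Field F] (h2 : (2 : F) ≠ 0) {D : F[X]} {N : ℕ}
    (hdeg : D.natDegree = 2 * N) {c : F} (hc : c ≠ 0) (hlead : D.leadingCoeff = c ^ 2) :
    ∃ t : LaurentSeries F, t ^ 2 = expandAtInfty F D := by
  obtain ⟨q, hq⟩ := powerSeries_exists_sq_eq h2 (D.reverse : PowerSeries F) hc
    (by simpa [coeff_zero_reverse] using hlead)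
  refine ⟨HahnSeries.ofPowerSeries ℤ F q * (HahnSeries.single (-1) 1) ^ N, ?_⟩
  rw [expandAtInfty_eq_reverse, hdeg, mul_pow, ← map_pow, hq, ← pow_mul, mul_comm N 2]

/-! ### Fields generated by a square root -/

section Quadratic

variable {k K : Type*} [Field k] [Field K] [Algebra k K] {d : k} {s : K}

lemma minpoly_sqrt (hs : s ^ 2 = algebraMap k K d) (hd : ¬ IsSquare d) :
    minpoly k s = X ^ 2 - C d := by
  symm
  apply minpoly.eq_of_irreducible_of_monic
  · exact X_pow_sub_C_irreducible_of_prime Nat.prime_two fun b hb => hd ⟨b, by rw [← hb, sq]⟩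
  · simp [hs]
  · exact monic_X_pow_sub_C d two_ne_zero

lemma isIntegral_sqrt (hs : s ^ 2 = algebraMap k K d) : IsIntegral k s :=
  IsIntegral.of_pow two_pos (hs ▸ isIntegral_algebraMap)

lemma exists_powerBasis_sqrt (hs : s ^ 2 = algebraMap k K d) (hd : ¬ IsSquare d)
    (htop : IntermediateField.adjoin k {s} = ⊤) :
    ∃ B : PowerBasis k K, B.gen = s ∧ B.dim = 2 := by
  let B := (IntermediateField.adjoin.powerBasis (isIntegral_sqrt hs)).map
    ((IntermediateField.equivOfEq htop).trans IntermediateField.topEquiv)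
  have hgen : B.gen = s := rfl
  refine ⟨B, hgen, ?_⟩
  rw [← B.natDegree_minpoly, hgen, minpoly_sqrt hs hd, natDegree_X_pow_sub_C]

lemma exists_eq_add_mul_sqrt (hs : s ^ 2 = algebraMap k K d) (hd : ¬ IsSquare d)
    (htop : IntermediateField.adjoin k {s} = ⊤) (x : K) :
    ∃ u v : k, x = algebraMap k K u + algebraMap k K v * s := by
  obtain ⟨B, hgen, hdim⟩ := exists_powerBasis_sqrt hs hd htop
  obtain ⟨p, hp, rfl⟩ := B.exists_eq_aeval x
  rw [hdim] at hp
  have h1 : p.natDegree ≤ 1 := by omega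
  rw [eq_X_add_C_of_natDegree_le_one h1, hgen]
  exact ⟨p.coeff 0, p.coeff 1, by simp [add_comm]⟩

lemma exists_algHom_sqrt (hs : s ^ 2 = algebraMap k K d) (hd : ¬ IsSquare d)
    (htop : IntermediateField.adjoin k {s} = ⊤) {L : Type*} [Field L] [Algebra k L] {t : L}
    (ht : t ^ 2 = algebraMap k L d) : ∃ φ : K →ₐ[k] L, φ s = t := by
  obtain ⟨B, hgen, -⟩ := exists_powerBasis_sqrt hs hd htop
  have h : aeval t (minpoly k B.gen) = 0 := by
    rw [hgen, minpoly_sqrt hs hd]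
    simp [ht]
  exact ⟨B.lift t h, by rw [← hgen, B.lift_gen]⟩

lemma exists_ringHom_sqrt (hs : s ^ 2 = algebraMap k K d) (hd : ¬ IsSquare d)
    (htop : IntermediateField.adjoin k {s} = ⊤) {L : Type*} [Field L] (ψ : k →+* L) {t : L}
    (ht : t ^ 2 = ψ d) : ∃ φ : K →+* L, ∀ x, φ (algebraMap k K x) = ψ x := by
  let _ := ψ.toAlgebra
  obtain ⟨φ, -⟩ := exists_algHom_sqrt hs hd htop (L := L) ht
  exact ⟨φ, φ.commutes⟩

lemma finiteDimensional_sqrt (hs : s ^ 2 = algebraMap k K d)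
    (htop : IntermediateField.adjoin k {s} = ⊤) : FiniteDimensional k K := by
  have := IntermediateField.adjoin.finiteDimensional (isIntegral_sqrt hs)
  rw [htop] at this
  exact Module.Finite.equiv (IntermediateField.topEquiv (F := k) (E := K)).toLinearEquiv

lemma isSeparable_sqrt (h2 : (2 : k) ≠ 0) (hs : s ^ 2 = algebraMap k K d) (hd : ¬ IsSquare d)
    (htop : IntermediateField.adjoin k {s} = ⊤) : Algebra.IsSeparable k K := by
  have hd0 : d ≠ 0 := fun h => hd (h ▸ IsSquare.zero)
  have hsep : IsSeparable k s := by
    rw [IsSeparable, minpoly_sqrt hs hd]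
    exact separable_X_pow_sub_C d (by exact_mod_cast h2) hd0
  have := (IntermediateField.isSeparable_adjoin_simple_iff_isSeparable k K).2 hsep
  rw [htop] at this
  exact Algebra.IsSeparable.of_algHom k (⊤ : IntermediateField k K)
    (IntermediateField.topEquiv (F := k) (E := K)).symm.toAlgHom

end Quadratic

/-! ### Pole orders at infinity -/

/-- The order of the pole at a place at infinity: an additive valuation, up to sign, that extends
the degree of polynomials. -/
structure PoleOrder (F K : Type*) [Field F] [Field K] [Algebra F[X] K] where
  toFun : K → ℤ
  map_mul : ∀ {x y : K}, x ≠ 0 → y ≠ 0 → toFun (x * y) = toFun x + toFun y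
  map_add_le : ∀ {x y : K}, x + y ≠ 0 → toFun (x + y) ≤ max (toFun x) (toFun y)
  map_algebraMap : ∀ {p : F[X]}, p ≠ 0 → toFun (algebraMap F[X] K p) = p.natDegree

lemma exists_poleOrder {F : Type*} [Field F] (h2 : (2 : F) ≠ 0) {D : F[X]} {N : ℕ}
    (hdeg : D.natDegree = 2 * N) {c : F} (hc : c ≠ 0) (hlead : D.leadingCoeff = c ^ 2)
    {K : Type*} [Field K] [Algebra F[X] K] [Algebra (RatFunc F) K]
    [IsScalarTower F[X] (RatFunc F) K] {s : K} (hs : s ^ 2 = algebraMap F[X] K D)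
    (hd : ¬ IsSquare (algebraMap F[X] (RatFunc F) D))
    (htop : IntermediateField.adjoin (RatFunc F) {s} = ⊤) : Nonempty (PoleOrder F K) := by
  have hinj : Function.Injective (expandAtInfty F) := by
    rw [injective_iff_map_eq_zero]
    intro p hp
    by_contra h
    exact (expandAtInfty_order h).1 hp
  obtain ⟨t, ht⟩ := exists_sq_eq_expandAtInfty h2 hdeg hc hlead
  rw [IsScalarTower.algebraMap_apply F[X] (RatFunc F) K] at hs
  obtain ⟨φ, hφ⟩ := exists_ringHom_sqrt hs hd htop (IsFractionRing.lift (K := RatFunc F) hinj)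
    (t := t) (by rw [ht, IsFractionRing.lift_algebraMap])
  refine ⟨⟨fun x => -(φ x).order, ?_, ?_, ?_⟩⟩
  · intro x y hx hy
    rw [map_mul, HahnSeries.order_mul (by simpa using hx) (by simpa using hy)]
    ring
  · intro x y hxy
    have := HahnSeries.min_order_le_order_add (x := φ x) (y := φ y)
      (by rw [← map_add]; exact (map_ne_zero φ).2 hxy)
    rw [map_add]
    omega
  · intro p hp
    rw [IsScalarTower.algebraMap_apply F[X] (RatFunc F) K, hφ, IsFractionRing.lift_algebraMap,
      (expandAtInfty_order hp).2]
    simp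

namespace PoleOrder

variable {F K : Type*} [Field F] [Field K] [Algebra F[X] K] (ν : PoleOrder F K)

lemma map_one : ν.toFun 1 = 0 := by
  have := ν.map_mul (x := 1) (y := 1) one_ne_zero one_ne_zero
  rw [mul_one] at this
  omega

lemma map_neg {x : K} (hx : x ≠ 0) : ν.toFun (-x) = ν.toFun x := by
  have h := ν.map_mul (neg_ne_zero.2 hx) (neg_ne_zero.2 hx)
  rw [neg_mul_neg, ν.map_mul hx hx] at h
  omega

lemma map_inv {x : K} (hx : x ≠ 0) : ν.toFun x⁻¹ = -ν.toFun x := by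
  have h := ν.map_mul hx (inv_ne_zero hx)
  rw [mul_inv_cancel₀ hx, ν.map_one] at h
  omega

lemma map_pow {x : K} (hx : x ≠ 0) (n : ℕ) : ν.toFun (x ^ n) = n * ν.toFun x := by
  induction n with
  | zero => simp [ν.map_one]
  | succ n ih => rw [pow_succ, ν.map_mul (pow_ne_zero _ hx) hx, ih]; push_cast; ring

lemma map_zpow {x : K} (hx : x ≠ 0) (n : ℤ) : ν.toFun (x ^ n) = n * ν.toFun x := by
  obtain ⟨m, rfl | rfl⟩ := n.eq_nat_or_neg
  · rw [zpow_natCast, ν.map_pow hx]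
  · rw [zpow_neg, zpow_natCast, ν.map_inv (pow_ne_zero _ hx), ν.map_pow hx]; ring

lemma map_sub_le {x y : K} (hy : y ≠ 0) (hxy : x - y ≠ 0) :
    ν.toFun (x - y) ≤ max (ν.toFun x) (ν.toFun y) := by
  rw [← ν.map_neg hy, sub_eq_add_neg]
  exact ν.map_add_le (by rwa [← sub_eq_add_neg])

end PoleOrder

/-! ### Units of the integral closure -/

/-- `x` is a unit of the integral closure of `F[T]`. -/
def IsIntegralUnit (F : Type*) {K : Type*} [Field F] [Field K] [Algebra F[X] K] (x : K) : Prop :=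
  x ≠ 0 ∧ IsIntegral F[X] x ∧ IsIntegral F[X] x⁻¹

namespace IsIntegralUnit

variable {F K : Type*} [Field F] [Field K] [Algebra F[X] K] {x y : K}

lemma mul (hx : IsIntegralUnit F x) (hy : IsIntegralUnit F y) : IsIntegralUnit F (x * y) :=
  ⟨mul_ne_zero hx.1 hy.1, hx.2.1.mul hy.2.1, by rw [mul_inv]; exact hx.2.2.mul hy.2.2⟩

lemma inv (hx : IsIntegralUnit F x) : IsIntegralUnit F x⁻¹ :=
  ⟨inv_ne_zero hx.1, hx.2.2, by rw [inv_inv]; exact hx.2.1⟩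

lemma pow (hx : IsIntegralUnit F x) (n : ℕ) : IsIntegralUnit F (x ^ n) :=
  ⟨pow_ne_zero _ hx.1, hx.2.1.pow n, by rw [← inv_pow]; exact hx.2.2.pow n⟩

lemma zpow (hx : IsIntegralUnit F x) (n : ℤ) : IsIntegralUnit F (x ^ n) := by
  obtain ⟨m, rfl | rfl⟩ := n.eq_nat_or_neg
  · rw [zpow_natCast]; exact hx.pow m
  · rw [zpow_neg, zpow_natCast]; exact (hx.pow m).inv

lemma of_isUnit {u : FunctionField.ringOfIntegers F K} (hu : IsUnit u) :
    IsIntegralUnit F (u : K) := by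
  obtain ⟨v, hv⟩ := hu.exists_right_inv
  have h : (u : K) * (v : K) = 1 := by exact_mod_cast congrArg Subtype.val hv
  refine ⟨left_ne_zero_of_mul_eq_one h, u.2, ?_⟩
  rw [inv_eq_of_mul_eq_one_right h]
  exact v.2

lemma map [Algebra (RatFunc F) K] [IsScalarTower F[X] (RatFunc F) K] (hx : IsIntegralUnit F x)
    (σ : K →ₐ[RatFunc F] K) : IsIntegralUnit F (σ x) :=
  ⟨(map_ne_zero σ).2 hx.1, hx.2.1.map σ, by rw [← map_inv₀]; exact hx.2.2.map σ⟩

end IsIntegralUnit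

/-! ### Divisibility between `f + s` and `g - s` -/

section Coprime

variable {R S : Type*} [CommRing R] [CommRing S] (ι : R →+* S) {D f g P κ : R} {s : S}

lemma isCoprime_add_sub_sqrt (hs : s ^ 2 = ι D) (hf : f ^ 2 - D = P) (h : IsCoprime (2 * f) P) :
    IsCoprime (ι f + s) (ι f - s) := by
  obtain ⟨a, b, hab⟩ := h
  have h1 := congrArg ι hab
  rw [← hf] at h1
  simp only [map_add, map_mul, map_sub, map_pow, map_one, ← hs, map_ofNat] at h1
  exact ⟨ι a + ι b * (ι f - s), ι a, by rw [← h1]; ring⟩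

/-- `f + s` divides `P`, hence also `g - s = (f + g) - (f + s)`, so it is coprime to `g + s`. As `(f
+ s) ^ d` divides `κ * P ^ d = (g - s) * (g + s)`, it must divide the first factor. -/
lemma pow_add_sqrt_dvd (hs : s ^ 2 = ι D) {d : ℕ} (hf : f ^ 2 - D = P) (hg : g ^ 2 - D = κ * P ^ d)
    (hdvd : d ≠ 0 → P ∣ f + g) (h : d ≠ 0 → IsCoprime (2 * g) P) :
    (ι f + s) ^ d ∣ ι g - s := by
  rcases eq_or_ne d 0 with rfl | hd
  · simp
  have hP : (ι f + s) * (ι f - s) = ι P := by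
    rw [← hf, map_sub, map_pow, ← hs]; ring
  have hfs : ι f + s ∣ ι P := ⟨_, hP.symm⟩
  have h1 : ι f + s ∣ ι g - s := by
    have : ι g - s = ι (f + g) - (ι f + s) := by rw [map_add]; ring
    rw [this]
    exact dvd_sub (hfs.trans (map_dvd ι (hdvd hd))) dvd_rfl
  have h2 : IsCoprime (ι f + s) (ι g + s) := by
    have h3 : IsCoprime (ι (2 * g)) (ι P) := (h hd).map ι
    have h4 : IsCoprime (ι (2 * g)) (ι f + s) := h3.of_isCoprime_of_dvd_right hfs
    obtain ⟨a, b, hab⟩ := h4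
    obtain ⟨z, hz⟩ := h1
    refine ⟨b + a * z, a, ?_⟩
    rw [← hab, map_mul, map_ofNat]
    linear_combination (-a) * hz
  refine IsCoprime.dvd_of_dvd_mul_right h2.pow_left ?_
  have h5 : (ι g - s) * (ι g + s) = ι κ * ι P ^ d := by
    rw [← map_pow, ← map_mul, ← hg, map_sub, map_pow, ← hs]; ring
  rw [h5]
  exact (pow_dvd_pow_of_dvd hfs d).mul_left _

/-- Apply the divisibility to `s` and to `-s`: comparing norms, the two cofactors multiply to the
unit `κ`. -/
lemma exists_isUnit_mul_pow_add_sqrt [IsDomain S] (hs : s ^ 2 = ι D) {d : ℕ} (hf : f ^ 2 - D = P)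
    (hg : g ^ 2 - D = κ * P ^ d) (hκ : IsUnit κ) (hP : ι P ≠ 0)
    (hdvd : d ≠ 0 → P ∣ f + g) (h : d ≠ 0 → IsCoprime (2 * g) P) :
    ∃ x, IsUnit x ∧ ι g - s = x * (ι f + s) ^ d := by
  obtain ⟨x, hx⟩ := pow_add_sqrt_dvd ι hs hf hg hdvd h
  obtain ⟨y, hy⟩ := pow_add_sqrt_dvd ι (s := -s) (by rwa [neg_sq]) hf hg hdvd h
  refine ⟨x, ?_, by rw [hx, mul_comm]⟩
  have hPd : (ι f + s) * (ι f + -s) = ι P := by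
    rw [← hf, map_sub, map_pow, ← hs]; ring
  have h1 : ι P ^ d * (x * y) = ι P ^ d * ι κ := by
    calc ι P ^ d * (x * y) = ((ι f + s) ^ d * x) * ((ι f + -s) ^ d * y) := by
          rw [← hPd, mul_pow]; ring
      _ = ι (g ^ 2 - D) := by rw [← hx, ← hy, map_sub, map_pow, ← hs]; ring
      _ = ι P ^ d * ι κ := by rw [hg, map_mul, map_pow]; ring
  have h2 := mul_left_cancel₀ (pow_ne_zero d hP) h1
  exact isUnit_of_mul_isUnit_left (h2 ▸ hκ.map ι)

end Coprime

/-! ### Lower bounds for pole orders and the contradiction -/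

section Core

variable {F K : Type*} [Field F] [Field K] [Algebra F[X] K] [Algebra (RatFunc F) K]
  [IsScalarTower F[X] (RatFunc F) K] (ν : PoleOrder F K) {D : F[X]} {N : ℕ} {s : K}

lemma exists_polynomial_of_isIntegral {r : RatFunc F}
    (h : IsIntegral F[X] (algebraMap (RatFunc F) K r)) :
    ∃ p : F[X], algebraMap F[X] (RatFunc F) p = r :=
  IsIntegrallyClosed.isIntegral_iff.1
    ((isIntegral_algebraMap_iff (algebraMap (RatFunc F) K).injective).1 h)

/-- The square of `v * s` is a polynomial `w`, and `w * D` is a polynomial square. Since `D` is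
squarefree, `w = D * V' ^ 2`, of degree at least `2 * N`. -/
lemma le_poleOrder_mul_sqrt (hsq : Squarefree D) (hdeg : D.natDegree = 2 * N)
    (hs : s ^ 2 = algebraMap F[X] K D) {v : RatFunc F}
    (hint : IsIntegral F[X] (algebraMap (RatFunc F) K v * s))
    (h0 : algebraMap (RatFunc F) K v * s ≠ 0) :
    (N : ℤ) ≤ ν.toFun (algebraMap (RatFunc F) K v * s) := by
  have hD := hsq.ne_zero
  have hinj : Function.Injective (algebraMap F[X] (RatFunc F)) := IsFractionRing.injective _ _
  have hy : (algebraMap (RatFunc F) K v * s) ^ 2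
      = algebraMap (RatFunc F) K (v ^ 2 * algebraMap F[X] (RatFunc F) D) := by
    rw [mul_pow, hs, map_mul, map_pow, ← IsScalarTower.algebraMap_apply]
  obtain ⟨w, hw⟩ := exists_polynomial_of_isIntegral (K := K) (hy ▸ hint.pow 2)
  have hw2 : (v * algebraMap F[X] (RatFunc F) D) ^ 2 = algebraMap F[X] (RatFunc F) (w * D) := by
    rw [map_mul, hw]; ring
  obtain ⟨V, hV⟩ := IsIntegrallyClosed.isIntegral_iff.1
    (IsIntegral.of_pow two_pos (hw2 ▸ isIntegral_algebraMap (R := F[X])))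
  have hVw : V ^ 2 = w * D := hinj (by rw [map_pow, hV, hw2])
  have hDV : D ∣ V := (hsq.dvd_pow_iff_dvd two_ne_zero).1 ⟨w, by rw [hVw, mul_comm]⟩
  obtain ⟨V', rfl⟩ := hDV
  have hw3 : w = D * V' ^ 2 := mul_right_cancel₀ hD (by rw [← hVw]; ring)
  have hK : (algebraMap (RatFunc F) K v * s) ^ 2 = algebraMap F[X] K w := by
    rw [hy, ← hw, ← IsScalarTower.algebraMap_apply]
  have hw0 : w ≠ 0 := by
    rintro rfl
    rw [map_zero] at hK
    exact h0 (pow_eq_zero_iff two_ne_zero |>.1 hK)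
  have h1 := ν.map_pow h0 2
  rw [hK, ν.map_algebraMap hw0] at h1
  have h2 : D.natDegree ≤ w.natDegree := natDegree_le_of_dvd ⟨_, hw3⟩ hw0
  push_cast at h1
  omega

/-- If `x` were fixed, `α ^ e` and its conjugate would be associated as well as coprime, hence
units; then their product `P ^ e` would be a unit, but `P` is not constant. -/
lemma conj_ne_self_of_pow_eq {f P : F[X]} (hs : s ^ 2 = algebraMap F[X] K D)
    (hP : f ^ 2 - D = P) (hPdeg : 0 < P.natDegree) (hcop : IsCoprime (2 * f) P)
    (σ : K →ₐ[RatFunc F] K) (hσ : σ s = -s)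
    {x u : K} {n e : ℕ} (he : 0 < e) (hu : IsIntegralUnit F u)
    (hx : x ^ n = u * (algebraMap F[X] K f + s) ^ e) : σ x ≠ x := by
  intro hfix
  have hσR : ∀ p : F[X], σ (algebraMap F[X] K p) = algebraMap F[X] K p := fun p => by
    rw [IsScalarTower.algebraMap_apply F[X] (RatFunc F) K, σ.commutes]
  set α := algebraMap F[X] K f + s with hα
  have hσα : σ α = algebraMap F[X] K f - s := by rw [hα, map_add, hσR, hσ]; ring
  have hαα : α * σ α = algebraMap F[X] K P := by
    rw [hσα, hα, ← hP, map_sub, map_pow, ← hs]; ring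
  have hsint : IsIntegral F[X] s := IsIntegral.of_pow two_pos (hs ▸ isIntegral_algebraMap)
  let sO : FunctionField.ringOfIntegers F K := ⟨s, hsint⟩
  have hcopO := (isCoprime_add_sub_sqrt (algebraMap F[X] (FunctionField.ringOfIntegers F K))
    (s := sO) (D := D) (Subtype.ext hs) hP hcop).pow (m := e) (n := e)
  obtain ⟨a, b, hab⟩ := hcopO
  have hab' : (a : K) * α ^ e + (b : K) * (σ α) ^ e = 1 := by
    rw [hσα]
    exact congrArg Subtype.val hab
  have hu' := hu.map σ
  have h1 : u * α ^ e = σ u * (σ α) ^ e := by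
    rw [← map_pow, ← map_mul, ← hx, map_pow, hfix]
  have h2 : ((a : K) + b * u * (σ u)⁻¹) * α ^ e = 1 := by
    rw [← hab']
    have := hu'.1
    field_simp
    linear_combination (b : K) * h1
  have h3 : IsIntegral F[X] ((α ^ e)⁻¹) := by
    rw [← eq_inv_of_mul_eq_one_left h2]
    exact IsIntegral.add a.2 (IsIntegral.mul (IsIntegral.mul b.2 hu.2.1) hu'.2.2)
  have h4 : IsIntegral F[X] ((α ^ e)⁻¹ * σ ((α ^ e)⁻¹)) := h3.mul (h3.map σ)
  have h5 : (α ^ e)⁻¹ * σ ((α ^ e)⁻¹)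
      = algebraMap (RatFunc F) K ((algebraMap F[X] (RatFunc F) P ^ e)⁻¹) := by
    rw [map_inv₀ (algebraMap (RatFunc F) K), map_pow (algebraMap (RatFunc F) K),
      ← IsScalarTower.algebraMap_apply, ← hαα, map_inv₀, map_pow, mul_pow, mul_inv]
  obtain ⟨w, hw⟩ := exists_polynomial_of_isIntegral (h5 ▸ h4)
  have hP0 : P ≠ 0 := by rintro rfl; simp at hPdeg
  have h6 : w * P ^ e = 1 := by
    apply IsFractionRing.injective F[X] (RatFunc F)
    rw [map_mul, hw, map_pow, map_one, inv_mul_cancel₀]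
    exact pow_ne_zero _ ((map_ne_zero_iff _ (IsFractionRing.injective _ _)).2 hP0)
  have h7 : IsUnit P := (isUnit_pow_iff he.ne').1 (IsUnit.of_mul_eq_one_right _ h6)
  have := natDegree_eq_zero_of_isUnit h7
  omega

/-- A generator of a positive power of the ideal has a pole of high order at one of the places
at infinity. -/
lemma le_poleOrder_or_le {f P : F[X]} (hsq : Squarefree D) (hdeg : D.natDegree = 2 * N)
    (hs : s ^ 2 = algebraMap F[X] K D)
    (hP : f ^ 2 - D = P) (hPdeg : 0 < P.natDegree) (hcop : IsCoprime (2 * f) P)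
    (σ : K →ₐ[RatFunc F] K) (hσ : σ s = -s)
    (hdecomp : ∀ x : K, ∃ u v : RatFunc F,
      x = algebraMap (RatFunc F) K u + algebraMap (RatFunc F) K v * s)
    {x u : K} {n e : ℕ} (hn : 0 < n) (he : 0 < e) (hu : IsIntegralUnit F u)
    (hx : x ^ n = u * (algebraMap F[X] K f + s) ^ e) :
    (N : ℤ) ≤ ν.toFun x ∨ (N : ℤ) ≤ ν.toFun (σ x) := by
  have hne := conj_ne_self_of_pow_eq hs hP hPdeg hcop σ hσ he hu hx
  have hsint : IsIntegral F[X] s := IsIntegral.of_pow two_pos (hs ▸ isIntegral_algebraMap)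
  have hxint : IsIntegral F[X] x := by
    refine IsIntegral.of_pow hn ?_
    rw [hx]
    exact hu.2.1.mul ((isIntegral_algebraMap.add hsint).pow e)
  obtain ⟨a, b, hab⟩ := hdecomp x
  have hdiff : x - σ x = algebraMap (RatFunc F) K (2 * b) * s := by
    rw [hab, map_add, map_mul, σ.commutes, σ.commutes, hσ, map_mul, map_ofNat]
    ring
  have h0 : x - σ x ≠ 0 := sub_ne_zero.2 hne.symm
  -- `x - σ x` is a nonzero multiple of `s`, so its order is at least `N`; the ultrametric
  -- inequality passes this bound to `x` or `σ x`.
  have hle := le_poleOrder_mul_sqrt ν hsq hdeg hs (v := 2 * b)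
    (hdiff ▸ hxint.sub (hxint.map σ)) (hdiff ▸ h0)
  rw [← hdiff] at hle
  have hx0 : x ≠ 0 := by
    rintro rfl
    exact h0 (by simp)
  have := ν.map_sub_le ((map_ne_zero σ).2 hx0) h0
  omega

lemma false_of_pow_eq {f P : F[X]} (hsq : Squarefree D) (hdeg : D.natDegree = 2 * N) (hN : 0 < N)
    (hs : s ^ 2 = algebraMap F[X] K D)
    (hP : f ^ 2 - D = P) (hPdeg : 0 < P.natDegree) (hcop : IsCoprime (2 * f) P)
    (σ : K →ₐ[RatFunc F] K) (hσ : σ s = -s)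
    (hdecomp : ∀ x : K, ∃ u v : RatFunc F,
      x = algebraMap (RatFunc F) K u + algebraMap (RatFunc F) K v * s)
    {η : K} (hη : IsIntegralUnit F η) {c : ℕ}
    (hα : ν.toFun (algebraMap F[X] K f + s) = N) (hα0 : algebraMap F[X] K f + s ≠ 0)
    (hθ : ν.toFun (η * (algebraMap F[X] K f + s) ^ c) = 0)
    (hθ' : ν.toFun (σ (η * (algebraMap F[X] K f + s) ^ c)) = N)
    {δ u : K} {n j : ℕ} (hj : 0 < j) (hjn : j < n) (hu : IsIntegralUnit F u)
    (hδ : δ ^ n = u * (algebraMap F[X] K f + s) ^ j) : False := by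
  have hbound : ∀ {x u : K} {e : ℕ}, 0 < e → IsIntegralUnit F u →
      x ^ n = u * (algebraMap F[X] K f + s) ^ e →
      (N : ℤ) ≤ ν.toFun x ∨ (N : ℤ) ≤ ν.toFun (σ x) := fun he hu hx =>
    le_poleOrder_or_le ν hsq hdeg hs hP hPdeg hcop σ hσ hdecomp (by omega) he hu hx
  set α := algebraMap F[X] K f + s with hαdef
  have hδ0 : δ ≠ 0 := by
    rintro rfl
    rw [zero_pow (by omega)] at hδ
    exact mul_ne_zero hu.1 (pow_ne_zero _ hα0) hδ.symm
  set θ := η * α ^ c with hθdef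
  have hθ0 : θ ≠ 0 := mul_ne_zero hη.1 (pow_ne_zero _ hα0)
  have hN' : (0 : ℤ) < N := by exact_mod_cast hN
  -- A power of `α` reduces the order at the first place modulo `N`.
  obtain ⟨y, hy⟩ : ∃ y, y = δ * α ^ (-(ν.toFun δ / N)) := ⟨_, rfl⟩
  have hy0 : y ≠ 0 := hy ▸ mul_ne_zero hδ0 (zpow_ne_zero _ hα0)
  -- `θ` has orders `(0, N)`, so its powers reduce the second order modulo `N` without changing the
  -- first.
  obtain ⟨x, hx⟩ : ∃ x, x = y * θ ^ (-(ν.toFun (σ y) / N)) := ⟨_, rfl⟩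
  have hx0 : x ≠ 0 := hx ▸ mul_ne_zero hy0 (zpow_ne_zero _ hθ0)
  have hσ0 : ∀ {z : K}, z ≠ 0 → σ z ≠ 0 := fun h => (map_ne_zero σ).2 h
  have hν1 : ν.toFun x = ν.toFun δ % N := by
    rw [hx, ν.map_mul hy0 (zpow_ne_zero _ hθ0), ν.map_zpow hθ0, hθ, hy,
      ν.map_mul hδ0 (zpow_ne_zero _ hα0), ν.map_zpow hα0, hα, Int.emod_def]
    ring
  have hν2 : ν.toFun (σ x) = ν.toFun (σ y) % N := by
    rw [hx, map_mul, map_zpow₀, ν.map_mul (hσ0 hy0) (zpow_ne_zero _ (hσ0 hθ0)),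
      ν.map_zpow (hσ0 hθ0), hθ', Int.emod_def]
    ring
  have h1 := Int.emod_nonneg (ν.toFun δ) hN'.ne'
  have h2 := Int.emod_lt_of_pos (ν.toFun δ) hN'
  have h3 := Int.emod_nonneg (ν.toFun (σ y)) hN'.ne'
  have h4 := Int.emod_lt_of_pos (ν.toFun (σ y)) hN'
  rw [← hν1] at h1 h2
  rw [← hν2] at h3 h4
  obtain ⟨w, e, hw, he, hxe⟩ : ∃ (w : K) (e : ℤ), IsIntegralUnit F w ∧ e ≠ 0 ∧
      x ^ n = w * α ^ e := by
    set i := -(ν.toFun δ / N)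
    set l := -(ν.toFun (σ y) / N)
    refine ⟨u * η ^ (l * n), j + n * (i + c * l), hu.mul (hη.zpow _), ?_, ?_⟩
    -- The exponent is congruent to `j` modulo `n`, and `0 < j < n`.
    · intro h0
      have hdvd : (n : ℤ) ∣ j := ⟨-(i + c * l), by linear_combination h0⟩
      have := Nat.le_of_dvd hj (Int.natCast_dvd_natCast.1 hdvd)
      omega
    · rw [hx, hy, hθdef, mul_pow, mul_pow, hδ, mul_zpow, mul_pow]
      simp only [← zpow_natCast, ← zpow_mul]
      rw [show (j : ℤ) + n * (i + c * l) = j + (i * n + c * l * n) by ring, zpow_add₀ hα0,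
        zpow_add₀ hα0]
      ring
  obtain ⟨b, hb | hb⟩ := e.eq_nat_or_neg
  · subst hb
    rw [zpow_natCast] at hxe
    have := hbound (by omega) hw hxe
    omega
  -- For a negative exponent the bound applies to `x⁻¹`, whose two pole orders are at most `0`.
  · subst hb
    rw [zpow_neg, zpow_natCast] at hxe
    have := hbound (x := x⁻¹) (u := w⁻¹) (e := b) (by omega) hw.inv
      (by rw [inv_pow, hxe, mul_inv, inv_inv])
    rw [map_inv₀, ν.map_inv hx0, ν.map_inv (hσ0 hx0)] at this
    omega

end Core

/-! ### The ideal class of order `n` -/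

/-- Coprime ideals whose product is an `n`-th power are themselves `n`-th powers, so `(α) = I ^ n`.
If `I ^ j = (δ)`, then `δ ^ n` and `α ^ j` are associated, which `H` forbids. -/
lemma exists_classGroup_orderOf_eq {O : Type*} [CommRing O] [IsDedekindDomain O] {α β u z : O}
    {n : ℕ} (hn : 0 < n) (hα : α ≠ 0) (hu : IsUnit u) (hmul : α * β = u * z ^ n)
    (hcop : IsCoprime α β)
    (H : ∀ j, 0 < j → j < n → ∀ δ v : O, IsUnit v → δ ^ n ≠ v * α ^ j) :
    ∃ x : ClassGroup O, orderOf x = n := by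
  obtain ⟨I, hI⟩ := exists_eq_pow_of_mul_eq_pow_of_coprime (R := Ideal O) (n := n)
    (a := Ideal.span {α}) (b := Ideal.span {β}) (c := Ideal.span {z})
    ((Ideal.isCoprime_span_singleton_iff α β).2 hcop) (by
      rw [Ideal.span_singleton_mul_span_singleton, hmul, Ideal.span_singleton_pow,
        Ideal.span_singleton_mul_left_unit hu])
  have hI0 : I ∈ nonZeroDivisors (Ideal O) := by
    rw [mem_nonZeroDivisors_iff_ne_zero]
    rintro rfl
    rw [zero_pow hn.ne'] at hI
    exact hα (Ideal.span_singleton_eq_bot.1 hI)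
  have hpow : ∀ m, ClassGroup.mk0 ⟨I, hI0⟩ ^ m = 1 ↔ (I ^ m).IsPrincipal := by
    intro m
    rw [← map_pow]
    exact ClassGroup.mk0_eq_one_iff (pow_mem hI0 m)
  refine ⟨ClassGroup.mk0 ⟨I, hI0⟩, (orderOf_eq_iff hn).2 ⟨(hpow n).2 ⟨α, hI.symm⟩, ?_⟩⟩
  intro j hjn hj hone
  obtain ⟨δ, hδ⟩ := ((hpow j).1 hone).principal
  have h1 : Ideal.span {α ^ j} = Ideal.span {δ ^ n} := by
    rw [← Ideal.span_singleton_pow, ← Ideal.span_singleton_pow, hI, pow_right_comm, hδ]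
  obtain ⟨v, hv⟩ := Ideal.span_singleton_eq_span_singleton.1 h1
  exact H j hj hjn δ v v.isUnit (by rw [← hv, mul_comm])

/-- A common prime `p` of `f` and `Z` would give `p ^ 2 ∣ D`; this is where the exponent must be at
least `2`. -/
lemma isCoprime_of_squarefree {F : Type*} [Field F] {D f w Z : F[X]} {k : ℕ} (hD : Squarefree D)
    (hk : 2 ≤ k) (h : f ^ 2 - D = w * Z ^ k) : IsCoprime f Z := by
  apply isCoprime_of_prime_dvd
  · rintro ⟨rfl, rfl⟩
    rw [zero_pow (by omega : k ≠ 0)] at h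
    exact hD.ne_zero (by linear_combination -h)
  · intro p hp hpf hpZ
    apply hp.not_isUnit
    apply hD
    have h1 : p * p ∣ f ^ 2 := by rw [sq]; exact mul_dvd_mul hpf hpf
    have h2 : p * p ∣ w * Z ^ k := by
      rw [← sq]
      exact ((pow_dvd_pow_of_dvd hpZ 2).trans (pow_dvd_pow Z hk)).mul_left w
    have h3 : D = f ^ 2 - w * Z ^ k := by linear_combination -h
    rw [h3]
    exact dvd_sub h1 h2

/-- `s` has order `deg f`, which bounds both orders above; the sum `2 * f` has exactly this order,
so one of the summands attains it. -/
lemma poleOrder_add_sqrt {F K : Type*} [Field F] [Field K] [Algebra F[X] K] (ν : PoleOrder F K)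
    (h2 : (2 : F) ≠ 0) {D f : F[X]} {s : K} (hs : s ^ 2 = algebraMap F[X] K D) (hs0 : s ≠ 0)
    (hf0 : f ≠ 0) (hD0 : D ≠ 0) (hdeg : D.natDegree = 2 * f.natDegree)
    (hadd : algebraMap F[X] K f + s ≠ 0) (hsub : algebraMap F[X] K f - s ≠ 0)
    (hinj : Function.Injective (algebraMap F[X] K)) :
    ν.toFun (algebraMap F[X] K f + s) ≤ f.natDegree ∧
    ν.toFun (algebraMap F[X] K f - s) ≤ f.natDegree ∧
    ((f.natDegree : ℤ) ≤ ν.toFun (algebraMap F[X] K f + s) ∨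
      (f.natDegree : ℤ) ≤ ν.toFun (algebraMap F[X] K f - s)) := by
  have h1 := ν.map_pow hs0 2
  rw [hs, ν.map_algebraMap hD0, hdeg] at h1
  push_cast at h1
  have hνf := ν.map_algebraMap hf0
  have h3 := ν.map_add_le hadd
  have h4 := ν.map_sub_le hs0 hsub
  have h2C : C (2 : F) * f ≠ 0 := mul_ne_zero (C_ne_zero.2 h2) hf0
  have h5 : algebraMap F[X] K f + s + (algebraMap F[X] K f - s) = algebraMap F[X] K (C 2 * f) := by
    rw [show (C (2 : F) : F[X]) = 2 from map_ofNat C 2, map_mul, map_ofNat]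
    ring
  have h6 := ν.map_add_le (x := algebraMap F[X] K f + s) (y := algebraMap F[X] K f - s)
    (by rw [h5]; exact (map_ne_zero_iff _ hinj).2 h2C)
  rw [h5, ν.map_algebraMap h2C, natDegree_C_mul h2] at h6
  omega

theorem exists_idealClass_orderOf_eq {F : Type*} [Field F] (h2 : (2 : F) ≠ 0)
    {A Z D f g : F[X]} {n d : ℕ} {c c' ε : F} (hn : 2 ≤ n) (hZ : 0 < Z.natDegree) (hA : A = Z ^ n)
    (hD : Squarefree D) (hc : c ≠ 0) (hc' : c' ≠ 0) (hε : ε ≠ 0)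
    (hf : f ^ 2 - D = C c * A) (hg : g ^ 2 - D = C c' * A ^ d) (hgf : g - f = C ε)
    (hfdeg : f.natDegree = max d 1 * A.natDegree)
    {K : Type*} [Field K] [Algebra F[X] K] [Algebra (RatFunc F) K]
    [IsScalarTower F[X] (RatFunc F) K] (hK : IsAdjoinSqrt F K D) :
    ∃ x : IdealClassGroup F K, orderOf x = n := by
  have hD0 := hD.ne_zero
  have hAdeg : 0 < A.natDegree := by
    rw [hA, natDegree_pow]; positivity
  set N := f.natDegree with hNdef
  have hAN : A.natDegree ≤ N := by
    rw [hfdeg]; exact Nat.le_mul_of_pos_left _ (by omega)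
  have hN : 0 < N := by omega
  have hA0 : A ≠ 0 := by rintro rfl; simp at hAdeg
  have hf0 : f ≠ 0 := by rintro rfl; simp [N] at hN
  have hPdeg : (C c * A).natDegree = A.natDegree := natDegree_C_mul hc
  have hDeq : D = f ^ 2 - C c * A := by linear_combination -hf
  have hlt : (C c * A).natDegree < (f ^ 2).natDegree := by
    rw [hPdeg, natDegree_pow]; omega
  have hdeg : D.natDegree = 2 * N := by
    rw [hDeq, natDegree_sub_eq_left_of_natDegree_lt hlt, natDegree_pow]
  have hlead : D.leadingCoeff = f.leadingCoeff ^ 2 := by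
    rw [hDeq, leadingCoeff_sub_of_degree_lt (degree_lt_degree hlt), leadingCoeff_pow]
  have hinj : Function.Injective (algebraMap F[X] (RatFunc F)) := IsFractionRing.injective _ _
  have hnsq : ¬ IsSquare (algebraMap F[X] (RatFunc F) D) := by
    rintro ⟨b, hb⟩
    rw [← sq] at hb
    obtain ⟨w, rfl⟩ := IsIntegrallyClosed.isIntegral_iff.1
      (IsIntegral.of_pow two_pos (hb ▸ isIntegral_algebraMap (R := F[X]) (x := D)))
    have hw : D = w * w := hinj (by rw [hb, map_mul, sq])
    have hwu : IsUnit w := hD w (by rw [← hw])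
    have := natDegree_eq_zero_of_isUnit (hw ▸ hwu.mul hwu)
    omega
  have hinjK : Function.Injective (algebraMap F[X] K) := by
    rw [IsScalarTower.algebraMap_eq F[X] (RatFunc F) K]
    exact (algebraMap (RatFunc F) K).injective.comp hinj
  obtain ⟨s₀, hs₀, htop⟩ := hK
  have h2k : (2 : RatFunc F) ≠ 0 := by
    have := (map_ne_zero (algebraMap F (RatFunc F))).2 h2
    rwa [map_ofNat] at this
  have hs₀' := hs₀
  rw [IsScalarTower.algebraMap_apply F[X] (RatFunc F) K] at hs₀'
  have : FunctionField F K := finiteDimensional_sqrt hs₀' htop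
  have : Algebra.IsSeparable (RatFunc F) K := isSeparable_sqrt h2k hs₀' hnsq htop
  obtain ⟨ν⟩ := exists_poleOrder h2 hdeg (leadingCoeff_ne_zero.2 hf0) hlead hs₀ hnsq htop
  obtain ⟨σ, hσ₀⟩ := exists_algHom_sqrt hs₀' hnsq htop (L := K) (t := -s₀) (by rw [neg_sq, hs₀'])
  have hs₀0 : s₀ ≠ 0 := by
    rintro rfl
    rw [zero_pow two_ne_zero] at hs₀
    exact hD0 ((map_eq_zero_iff _ hinjK).1 hs₀.symm)
  have hprod : ∀ {s : K} {h P : F[X]}, s ^ 2 = algebraMap F[X] K D → h ^ 2 - D = P →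
      (algebraMap F[X] K h + s) * (algebraMap F[X] K h - s) = algebraMap F[X] K P := by
    intro s h P hs hP
    rw [← hP, map_sub, map_pow, ← hs]; ring
  have hP0 : C c * A ≠ 0 := mul_ne_zero (C_ne_zero.2 hc) hA0
  have hQ0 : C c' * A ^ d ≠ 0 := mul_ne_zero (C_ne_zero.2 hc') (pow_ne_zero _ hA0)
  have hne : ∀ {s : K} {h P : F[X]}, s ^ 2 = algebraMap F[X] K D → h ^ 2 - D = P → P ≠ 0 →
      algebraMap F[X] K h + s ≠ 0 ∧ algebraMap F[X] K h - s ≠ 0 := by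
    intro s h P hs hP hP0
    rw [← mul_ne_zero_iff, hprod hs hP]
    exact (map_ne_zero_iff _ hinjK).2 hP0
  -- The sign of the square root is chosen so that `f + s`, rather than `f - s`, has the full order
  -- `N`.
  obtain ⟨s, hs, hs0, hσ, hdecomp, hα⟩ : ∃ s : K, s ^ 2 = algebraMap F[X] K D ∧ s ≠ 0 ∧ σ s = -s ∧
      (∀ x : K, ∃ u v : RatFunc F, x = algebraMap (RatFunc F) K u + algebraMap (RatFunc F) K v * s) ∧
      ν.toFun (algebraMap F[X] K f + s) = N := by
    have hdec := exists_eq_add_mul_sqrt hs₀' hnsq htop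
    obtain ⟨ha, hb⟩ := hne hs₀ hf hP0
    obtain ⟨h3, h4, h5 | h5⟩ := poleOrder_add_sqrt ν h2 hs₀ hs₀0 hf0 hD0 hdeg ha hb hinjK
    · exact ⟨s₀, hs₀, hs₀0, hσ₀, hdec, le_antisymm h3 h5⟩
    · refine ⟨-s₀, by rw [neg_sq, hs₀], neg_ne_zero.2 hs₀0, by rw [map_neg, hσ₀], fun x => ?_, ?_⟩
      · obtain ⟨u, v, h⟩ := hdec x
        exact ⟨u, -v, by rw [h, map_neg]; ring⟩
      · rw [← sub_eq_add_neg]; exact le_antisymm h4 h5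
  have hgdeg : g.natDegree = N := by
    rw [show g = f + C ε by linear_combination hgf]
    exact natDegree_add_C
  have hg0 : g ≠ 0 := by rintro rfl; simp at hgdeg; omega
  have hσR : ∀ p : F[X], σ (algebraMap F[X] K p) = algebraMap F[X] K p := fun p => by
    rw [IsScalarTower.algebraMap_apply F[X] (RatFunc F) K, σ.commutes]
  obtain ⟨hfa, hfs⟩ := hne hs hf hP0
  obtain ⟨hga, hgs⟩ := hne hs hg hQ0
  have hα' : ν.toFun (algebraMap F[X] K f - s) = A.natDegree - N := by
    have := ν.map_mul hfa hfs
    rw [hprod hs hf, ν.map_algebraMap hP0, hPdeg] at this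
    omega
  have hgsum : ν.toFun (algebraMap F[X] K g + s) + ν.toFun (algebraMap F[X] K g - s)
      = d * A.natDegree := by
    rw [← ν.map_mul hga hgs, hprod hs hg, ν.map_algebraMap hQ0, natDegree_C_mul hc', natDegree_pow]
    push_cast
    rfl
  -- `g - s` is `f - s`, of order `deg A - N ≤ 0`, plus the constant `ε`.
  have hgs_le : ν.toFun (algebraMap F[X] K g - s) ≤ 0 := by
    have h1 : algebraMap F[X] K g - s = (algebraMap F[X] K f - s) + algebraMap F[X] K (C ε) := by
      rw [← hgf, map_sub]; ring
    have h3 := ν.map_add_le (h1 ▸ hgs)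
    rw [← h1, ν.map_algebraMap (C_ne_zero.2 hε), natDegree_C] at h3
    push_cast at h3
    omega
  have hga_eq : ν.toFun (algebraMap F[X] K g + s) = N := by
    obtain ⟨h3, h4, h5⟩ := poleOrder_add_sqrt ν h2 hs hs0 hg0 hD0 (by rw [hgdeg, hdeg]) hga hgs hinjK
    rw [hgdeg] at h3 h4 h5
    omega
  have h2u : IsUnit (2 : F[X]) := by
    rw [← show (C (2 : F) : F[X]) = 2 from map_ofNat C 2]
    exact isUnit_C.2 h2.isUnit
  have hcop : IsCoprime (2 * f) (C c * A) := by
    have h3 : IsCoprime f Z := isCoprime_of_squarefree hD hn (w := C c) (by rw [hf, hA])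
    rw [isCoprime_mul_unit_left_left h2u, isCoprime_mul_unit_left_right (isUnit_C.2 hc.isUnit), hA]
    exact h3.pow_right
  have hcopg : d ≠ 0 → IsCoprime (2 * g) (C c * A) := by
    intro hd
    have h3 : IsCoprime g Z := isCoprime_of_squarefree hD (k := n * d)
      (hn.trans (Nat.le_mul_of_pos_right _ (by omega))) (w := C c') (by rw [hg, hA, pow_mul])
    rw [isCoprime_mul_unit_left_left h2u, isCoprime_mul_unit_left_right (isUnit_C.2 hc.isUnit), hA]
    exact h3.pow_right
  have hdvd : d ≠ 0 → C c * A ∣ f + g := by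
    intro hd
    obtain ⟨e, rfl⟩ := Nat.exists_eq_succ_of_ne_zero hd
    rw [(isUnit_C.2 hc.isUnit).mul_left_dvd]
    rw [Nat.succ_eq_add_one, pow_succ] at hg
    refine ⟨C ε⁻¹ * (C c' * A ^ e - C c), ?_⟩
    -- This is `g ^ 2 - f ^ 2`, computed from the two norm equations.
    have h3 : (f + g) * C ε = A * (C c' * A ^ e - C c) := by
      rw [← hgf]
      linear_combination hg - hf
    have h4 : (C ε : F[X]) * C ε⁻¹ = 1 := by rw [← C_mul, mul_inv_cancel₀ hε, C_1]
    linear_combination C ε⁻¹ * h3 - (f + g) * h4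
  have hκ : g ^ 2 - D = C (c' / c ^ d) * (C c * A) ^ d := by
    rw [hg, mul_pow, ← mul_assoc, ← C_pow, ← C_mul, div_mul_cancel₀ _ (pow_ne_zero _ hc)]
  have hsint : IsIntegral F[X] s := IsIntegral.of_pow two_pos (hs ▸ isIntegral_algebraMap)
  let sO : FunctionField.ringOfIntegers F K := ⟨s, hsint⟩
  have hsO : sO ^ 2 = algebraMap F[X] (FunctionField.ringOfIntegers F K) D := Subtype.ext hs
  set ι := algebraMap F[X] (FunctionField.ringOfIntegers F K) with hι
  have hιinj : Function.Injective ι := FunctionField.ringOfIntegers.algebraMap_injective F K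
  obtain ⟨η, hηu, hη⟩ := exists_isUnit_mul_pow_add_sqrt ι hsO hf hκ
    (isUnit_C.2 (div_ne_zero hc' (pow_ne_zero _ hc)).isUnit)
    ((map_ne_zero_iff _ hιinj).2 hP0) hdvd hcopg
  have hηK : algebraMap F[X] K g - s = (η : K) * (algebraMap F[X] K f + s) ^ d :=
    congrArg Subtype.val hη
  -- For `d ≥ 1` this is `g - s`. For `d = 0`, `g - s` is a unit of orders `(-N, N)`, and one more
  -- factor `α`, of orders `(N, 0)`, is needed.
  have hθ : (η : K) * (algebraMap F[X] K f + s) ^ max d 1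
      = (algebraMap F[X] K g - s) * (algebraMap F[X] K f + s) ^ (max d 1 - d) := by
    rw [hηK, mul_assoc, ← pow_add]
    congr 2
    omega
  have hνθ : ν.toFun ((η : K) * (algebraMap F[X] K f + s) ^ max d 1) = 0 := by
    rw [hθ, ν.map_mul hgs (pow_ne_zero _ hfa), ν.map_pow hfa, hα]
    rcases Nat.eq_zero_or_pos d with rfl | hd
    · simp at hgsum ⊢
      omega
    · rw [max_eq_left hd] at hfdeg ⊢
      have : (N : ℤ) = d * A.natDegree := by exact_mod_cast hfdeg
      simp
      omega
  have hνθ' : ν.toFun (σ ((η : K) * (algebraMap F[X] K f + s) ^ max d 1)) = N := by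
    rw [hθ, map_mul, map_pow, map_sub, map_add, hσR, hσR, hσ, sub_neg_eq_add, ← sub_eq_add_neg,
      ν.map_mul hga (pow_ne_zero _ hfs), ν.map_pow hfs, hα', hga_eq]
    rcases Nat.eq_zero_or_pos d with rfl | hd
    · simp at hfdeg ⊢
      omega
    · rw [max_eq_left hd]
      simp
  refine exists_classGroup_orderOf_eq (O := FunctionField.ringOfIntegers F K) (α := ι f + sO)
    (β := ι f - sO) (u := ι (C c)) (z := ι Z) (by omega) ?_ ((isUnit_C.2 hc.isUnit).map ι) ?_
    (isCoprime_add_sub_sqrt ι hsO hf hcop) ?_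
  · exact fun h => hfa (congrArg Subtype.val h)
  · rw [← map_pow, ← hA, ← map_mul, ← hf, map_sub, map_pow, ← hsO]
    ring
  · intro j hj hjn δ v hv h
    exact false_of_pow_eq ν hD hdeg hN hs hf (by omega) hcop σ hσ hdecomp
      (IsIntegralUnit.of_isUnit hηu) hα hfa hνθ hνθ' hj hjn (IsIntegralUnit.of_isUnit hv)
      (congrArg Subtype.val h : (δ : K) ^ n = v * (algebraMap F[X] K f + s) ^ j)

/-! ### Exclusion of ERD and GERD types -/

/-- If `D` is close to `f₀²`, a representation `D = f² + r` with `r ∣ f` has `f = f₀`, up to sign. -/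
lemma not_dvd_of_eq_sq_add {F : Type*} [Field F] (h2 : (2 : F) ≠ 0) {f₀ A f r : F[X]} {c : F}
    (hA : 0 < A.natDegree) (hAf : A.natDegree < f₀.natDegree) (hndvd : ¬ A ∣ f₀) (hc : c ≠ 0)
    (hf : f ≠ 0) (h : f₀ ^ 2 - C c * A = f ^ 2 + r) : ¬ r ∣ f := by
  intro hr
  have h2u : (C (2 : F) : F[X]) = 2 := map_ofNat C 2
  have hAc : (C c * A).natDegree = A.natDegree := natDegree_C_mul hc
  have hrdeg : r.natDegree ≤ f.natDegree := natDegree_le_of_dvd hr hf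
  have hfdeg : f.natDegree = f₀.natDegree := by
    have h1 : (f₀ ^ 2 - C c * A).natDegree = 2 * f₀.natDegree := by
      rw [natDegree_sub_eq_left_of_natDegree_lt (by rw [hAc, natDegree_pow]; omega), natDegree_pow]
    have h3 : (f ^ 2 + r).natDegree = 2 * f.natDegree := by
      rcases Nat.eq_zero_or_pos f.natDegree with h0 | hpos
      · have := natDegree_add_le (f ^ 2) r
        rw [natDegree_pow] at this
        omega
      · rw [natDegree_add_eq_left_of_natDegree_lt (by rw [natDegree_pow]; omega), natDegree_pow]
    rw [h, h3] at h1
    omega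
  -- Since `(f + f₀) + (-f + f₀) = 2 * f₀`, one choice of sign prevents a drop in degree.
  wlog hsum : f₀.natDegree ≤ (f + f₀).natDegree generalizing f
  · refine this (f := -f) (neg_ne_zero.2 hf) (by rw [neg_sq, h]) ((dvd_neg).2 hr)
      (by rwa [natDegree_neg]) (by rwa [natDegree_neg]) ?_
    have h4 : (C 2 * f₀).natDegree ≤ max (f + f₀).natDegree (-f + f₀).natDegree := by
      rw [show C 2 * f₀ = (f + f₀) + (-f + f₀) by rw [h2u]; ring]
      exact natDegree_add_le _ _
    rw [natDegree_C_mul h2] at h4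
    omega
  have hprod : (f - f₀) * (f + f₀) = -(C c * A) - r := by linear_combination -h
  -- `(f - f₀) * (f + f₀)` has degree at most `deg f₀`, already reached by the second factor.
  obtain ⟨κ, hκ⟩ : ∃ κ, f - f₀ = C κ := by
    rcases eq_or_ne (f - f₀) 0 with h0 | h0
    · exact ⟨0, by rw [h0, C_0]⟩
    have h5 : f + f₀ ≠ 0 := by
      intro h5
      rw [h5, natDegree_zero] at hsum
      omega
    have h6 := natDegree_mul h0 h5
    rw [hprod] at h6
    have h7 := natDegree_sub_le (-(C c * A)) r
    rw [natDegree_neg, hAc] at h7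
    exact ⟨_, eq_C_of_natDegree_eq_zero (by omega)⟩
  have hfκ : f = f₀ + C κ := by linear_combination hκ
  rcases eq_or_ne κ 0 with rfl | hκ0
  · rw [C_0, add_zero] at hfκ
    subst hfκ
    have h8 : r = -(C c * A) := by linear_combination -h
    rw [h8, neg_dvd, (isUnit_C.2 hc.isUnit).mul_left_dvd] at hr
    exact hndvd hr
  · have h9 : r = C (-2 * κ) * f₀ + (-(C c * A) - C (κ ^ 2)) := by
      rw [C_mul, C_neg, h2u, C_pow]
      rw [hfκ] at h
      linear_combination -h
    have hsmall : (-(C c * A) - C (κ ^ 2)).natDegree ≤ A.natDegree := by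
      have := natDegree_sub_le (-(C c * A)) (C (κ ^ 2))
      rw [natDegree_neg, hAc, natDegree_C] at this
      omega
    have h2κ : -2 * κ ≠ 0 := mul_ne_zero (neg_ne_zero.2 h2) hκ0
    have hrN : r.natDegree = f.natDegree := by
      rw [h9, natDegree_add_eq_left_of_natDegree_lt, natDegree_C_mul h2κ, hfdeg]
      rw [natDegree_C_mul h2κ]
      omega
    obtain ⟨q, hq⟩ := hr
    have hr0 : r ≠ 0 := by rintro rfl; exact hf (by rw [hq, zero_mul])
    have hq0 : q ≠ 0 := by rintro rfl; exact hf (by rw [hq, mul_zero])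
    have h10 := natDegree_mul hr0 hq0
    rw [← hq, hrN] at h10
    obtain ⟨l, rfl⟩ : ∃ l, q = C l := ⟨_, eq_C_of_natDegree_eq_zero (by omega)⟩
    have hl : l ≠ 0 := fun h0 => hq0 (by rw [h0, C_0])
    -- Expanding `f = r * l`: the left side is zero or of degree `deg f₀`, while the right side has
    -- degree `deg A`, strictly between.
    have h11 : C (1 + 2 * κ * l) * f₀ = C (-(c * l)) * A + C (-(κ ^ 2 * l) - κ) := by
      rw [hfκ, h9] at hq
      simp only [C_add, C_mul, C_neg, C_sub, C_pow, C_1, h2u] at hq ⊢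
      linear_combination hq
    have hRHS : (C (-(c * l)) * A + C (-(κ ^ 2 * l) - κ)).natDegree = A.natDegree := by
      rw [natDegree_add_C, natDegree_C_mul (neg_ne_zero.2 (mul_ne_zero hc hl))]
    rw [← h11] at hRHS
    rcases eq_or_ne (1 + 2 * κ * l) 0 with h0 | h0
    · rw [h0, C_0, zero_mul, natDegree_zero] at hRHS
      omega
    · rw [natDegree_C_mul h0] at hRHS
      omega

/-- As `2` is a unit, the GERD condition also reduces to `r ∣ f`. -/
lemma not_isERD_of_eq_sq_sub {F : Type*} [Field F] (h2 : (2 : F) ≠ 0) {D f₀ A : F[X]} {c : F}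
    (hA : 0 < A.natDegree) (hAf : A.natDegree < f₀.natDegree) (hndvd : ¬ A ∣ f₀) (hc : c ≠ 0)
    (hD : f₀ ^ 2 - D = C c * A) : ¬ IsERD D ∧ ¬ IsGERD D := by
  have hD' : f₀ ^ 2 - C c * A = D := by linear_combination hD
  constructor
  · rintro ⟨f, r, hf, h, hr⟩
    exact not_dvd_of_eq_sq_add h2 hA hAf hndvd hc hf (hD'.trans h) hr
  · rintro ⟨f, r, m, -, hf, h, hr⟩
    have h2u : IsUnit ((2 : F[X]) ^ m) := by
      rw [← show (C (2 : F) : F[X]) = 2 from map_ofNat C 2]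
      exact (isUnit_C.2 h2.isUnit).pow m
    exact not_dvd_of_eq_sq_add h2 hA hAf hndvd hc hf (hD'.trans h) (h2u.dvd_mul_left.1 hr)

/-! ### The four forms of `D` -/

lemma natDegree_C_mul_add_C {F : Type*} [Field F] {e : F} (he : e ≠ 0) (e' : F) (a : F[X]) :
    (C e * a + C e').natDegree = a.natDegree := by
  rw [natDegree_add_C, natDegree_C_mul he]

/-- Cancellation of leading terms is possible only for `d = 1`, where the coefficient of `a` is `2 +
e`; with `e = 1` it vanishes in characteristic `3`. -/
lemma natDegree_pow_add_linear {F : Type*} [Field F] {a A : F[X]} {d : ℕ} {e e' : F}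
    (h2 : (2 : F) ≠ 0) (ha : 0 < a.natDegree) (hA : A = C 2 * a + C 1) (he : e ≠ 0)
    (hd : d = 1 → 2 + e ≠ 0) :
    (A ^ d + (C e * a + C e')).natDegree = max d 1 * A.natDegree := by
  have hAdeg : A.natDegree = a.natDegree := by rw [hA, natDegree_C_mul_add_C h2]
  rcases lt_trichotomy d 1 with h | h | h
  · obtain rfl : d = 0 := by omega
    rw [pow_zero, add_comm, add_assoc, ← C_1, ← C_add, natDegree_C_mul_add_C he, hAdeg]
    simp
  · rw [h, pow_one]
    rw [show A + (C e * a + C e') = C (2 + e) * a + C (1 + e') by rw [hA]; simp only [C_add]; ring,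
      natDegree_C_mul_add_C (hd h), hAdeg]
    simp
  · rw [max_eq_left (by omega), natDegree_add_eq_left_of_natDegree_lt, natDegree_pow]
    rw [natDegree_pow, natDegree_C_mul_add_C he, hAdeg]
    exact lt_mul_of_one_lt_left ha h

/-- Modulo `A`, twice `e * a + e'` is the nonzero constant `2 * e' - e`. -/
lemma not_dvd_pow_add_linear {F : Type*} [Field F] {a A : F[X]} {d : ℕ} {e e' : F}
    (hAdeg : 0 < A.natDegree) (hA : A = C 2 * a + C 1) (hd : d ≠ 0) (he : 2 * e' - e ≠ 0) :
    ¬ A ∣ A ^ d + (C e * a + C e') := by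
  intro h
  rw [dvd_add_right (dvd_pow_self A hd)] at h
  have h1 : A ∣ C (2 * e' - e) := by
    have h3 : C (2 * e' - e) = C 2 * (C e * a + C e') - C e * A := by
      rw [hA, C_sub, C_mul, C_1]; ring
    rw [h3]
    exact dvd_sub (h.mul_left _) (dvd_mul_left _ _)
  have := natDegree_le_of_dvd h1 (C_ne_zero.2 he)
  rw [natDegree_C] at this
  omega

lemma exists_cyclic_subgroup_and_not_isERD {F : Type*} [Field F] (h2 : (2 : F) ≠ 0)
    {a A Z D f g : F[X]} {n d : ℕ} {c c' ε e e' : F} (hn : 1 ≤ n) (ha : 0 < a.natDegree)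
    (hA : A = C 2 * a + C 1) (hZ : 0 < Z.natDegree) (hAZ : A = Z ^ n)
    (hD : Squarefree D) (hc : c ≠ 0) (hc' : c' ≠ 0) (hε : ε ≠ 0)
    (hf : f ^ 2 - D = C c * A) (hg : g ^ 2 - D = C c' * A ^ d) (hgf : g - f = C ε)
    (hfe : f = A ^ d + (C e * a + C e')) (he : e ≠ 0) (hd : d = 1 → 2 + e ≠ 0)
    (hee : 2 * e' - e ≠ 0)
    {K : Type*} [Field K] [Algebra F[X] K] [Algebra (RatFunc F) K]
    [IsScalarTower F[X] (RatFunc F) K] (hK : IsAdjoinSqrt F K D) :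
    (∃ H : Subgroup (IdealClassGroup F K), IsCyclic H ∧ Nat.card H = n) ∧
      (2 ≤ d → ¬ IsERD D ∧ ¬ IsGERD D) := by
  have hfdeg : f.natDegree = max d 1 * A.natDegree := by
    rw [hfe]; exact natDegree_pow_add_linear h2 ha hA he hd
  have hAdeg : 0 < A.natDegree := by rwa [hA, natDegree_C_mul_add_C h2]
  constructor
  · rcases hn.eq_or_lt with rfl | hn
    -- The coprimality argument needs `n ≥ 2`; for `n = 1` the trivial subgroup suffices.
    · exact ⟨⊥, inferInstance, by simp⟩
    · obtain ⟨x, hx⟩ := exists_idealClass_orderOf_eq h2 hn hZ hAZ hD hc hc' hε hf hg hgf hfdeg hK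
      exact ⟨Subgroup.zpowers x, inferInstance, by rw [Nat.card_zpowers, hx]⟩
  · intro hd2
    refine not_isERD_of_eq_sq_sub h2 hAdeg ?_ ?_ hc hf
    · rw [hfdeg, max_eq_left (by omega)]
      exact lt_mul_of_one_lt_left hAdeg (by omega)
    · rw [hfe]
      exact not_dvd_pow_add_linear hAdeg hA (by omega) hee

theorem theorem3 (F : Type*) [Field F] [Finite F]
    (a A Z D : F[X]) (n d : ℕ) (hn : 1 ≤ n)
    (ha : 0 < a.natDegree) (hA : A = 2 * a + 1) (hAm : A.Monic)
    (hZ : 0 < Z.natDegree) (hAZ : A = Z ^ n)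
    (hD : (D = (A ^ d + a) ^ 2 + A ∧ ¬ (d = 1 ∧ CharP F 3)) ∨
      D = (A ^ d - a) ^ 2 + A ∨
      (D = (A ^ d + a + 1) ^ 2 - A ∧ ¬ (d = 1 ∧ CharP F 3)) ∨
      D = (A ^ d - a - 1) ^ 2 - A)
    (hsq : Squarefree D)
    (K : Type*) [Field K] [Algebra F[X] K] [Algebra (RatFunc F) K]
    [IsScalarTower F[X] (RatFunc F) K] (hK : IsAdjoinSqrt F K D) :
    (∃ H : Subgroup (IdealClassGroup F K), IsCyclic H ∧ Nat.card H = n) ∧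
      (2 ≤ d → ¬ IsERD D ∧ ¬ IsGERD D) := by
  have hC2 : (C (2 : F) : F[X]) = 2 := map_ofNat C 2
  have h2 : (2 : F) ≠ 0 := by
    intro h0
    have h1 : A = 1 := by rw [hA, ← hC2, h0, C_0, zero_mul, zero_add]
    have h3 : A.natDegree = n * Z.natDegree := by rw [hAZ, natDegree_pow]
    rw [h1, natDegree_one] at h3
    exact (Nat.mul_pos hn hZ).ne h3
  have h3 : ¬ (d = 1 ∧ CharP F 3) → d = 1 → (2 + 1 : F) ≠ 0 := by
    rintro h rfl h0
    refine h ⟨rfl, ringChar.of_eq (CharP.ringChar_of_prime_eq_zero Nat.prime_three ?_)⟩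
    push_cast
    linear_combination h0
  have hA' : A = C 2 * a + C 1 := by rw [hC2, C_1, hA]
  have h21 : (2 + -1 : F) ≠ 0 := by norm_num
  rcases hD with ⟨hD, hd⟩ | hD | ⟨hD, hd⟩ | hD
  -- In every form `g = f ± 1`: the cross term `±2 * f` and `A = 2 * a + 1` cancel all of `g ^ 2 -
  -- D` except `±2 * A ^ d`.
  · refine exists_cyclic_subgroup_and_not_isERD h2 (f := A ^ d + a) (g := A ^ d + a + 1) (c := -1)
      (c' := 2) (ε := 1) (e := 1) (e' := 0) hn ha hA' hZ hAZ hsq (by simp) h2 one_ne_zero ?_ ?_ ?_ ?_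
      one_ne_zero (h3 hd) (by simp) hK <;> simp only [hD, C_neg, C_1, C_0, hC2]
    · ring
    · linear_combination (-1 : F[X]) * hA
    · ring
    · ring
  · refine exists_cyclic_subgroup_and_not_isERD h2 (f := A ^ d - a) (g := A ^ d - a - 1) (c := -1)
      (c' := -2) (ε := -1) (e := -1) (e' := 0) hn ha hA' hZ hAZ hsq (by simp) (neg_ne_zero.2 h2)
      (by simp) ?_ ?_ ?_ ?_ (by simp) (fun _ => h21) (by simp) hK <;>
      simp only [hD, C_neg, C_1, C_0, hC2]
    · ring
    · linear_combination (-1 : F[X]) * hA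
    · ring
    · ring
  · refine exists_cyclic_subgroup_and_not_isERD h2 (f := A ^ d + a + 1) (g := A ^ d + a) (c := 1)
      (c' := -2) (ε := -1) (e := 1) (e' := 1) hn ha hA' hZ hAZ hsq (by simp) (neg_ne_zero.2 h2)
      (by simp) ?_ ?_ ?_ ?_ one_ne_zero (h3 hd) (by norm_num) hK <;>
      simp only [hD, C_neg, C_1, hC2]
    · ring
    · linear_combination hA
    · ring
    · ring
  · refine exists_cyclic_subgroup_and_not_isERD h2 (f := A ^ d - a - 1) (g := A ^ d - a) (c := 1)
      (c' := 2) (ε := 1) (e := -1) (e' := -1) hn ha hA' hZ hAZ hsq (by simp) h2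
      one_ne_zero ?_ ?_ ?_ ?_ (by simp) (fun _ => h21) (by norm_num) hK <;>
      simp only [hD, C_neg, C_1, hC2]
    · ring
    · linear_combination hA
    · ring
    · ring
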